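/- All graphs are finite, simple, undirected and connected. For a graph $G$ let $$AZI(G)=\sum_{uv\in E(G)}\left(\frac{d_u d_v}{d_u+d_v-2}\right)^3$$ be its augmented Zagreb index, where $d_u$ denotes the degree of the vertex $u$. A cactus is a connected graph in which every edge lies on at most one cycle. Let $G$ be a cactus with $n\ge 4$ vertices. Then $$AZI(G)\ \ge\ (n-1)\left(\frac{n-1}{n-2}\right)^3,$$ and equality holds if and only if $G$ is isomorphic to the star $S_n$ on $n$ vertices. -/

import Mathlib

/-- The augmented Zagreb index
`∑_{uv ∈ E(G)} (d_u d_v / (d_u + d_v - 2)) ^ 3` of a finite graph (the arithmetic is in `ℝ`). -/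
noncomputable def augmentedZagrebIndex {V : Type*} [Fintype V] [DecidableEq V]
    (G : SimpleGraph V) [DecidableRel G.Adj] : ℝ :=
  ∑ e ∈ G.edgeFinset,
    Sym2.lift ⟨fun u v : V =>
      (((G.degree u : ℝ) * (G.degree v : ℝ)) / ((G.degree u : ℝ) + (G.degree v : ℝ) - 2)) ^ 3,
      fun u v => by
        simp only [mul_comm (G.degree u : ℝ), add_comm (G.degree u : ℝ)]⟩ e

/-- A cactus: a connected graph in which every edge lies on at most one cycle. Two closed walks
that traverse the same cycle from different base points or in different directions are the
same cycle, so cycles are compared as subgraphs. -/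
def IsCactus {V : Type*} (G : SimpleGraph V) : Prop :=
  G.Connected ∧
    ∀ (e : Sym2 V) (u v : V) (p : G.Walk u u) (q : G.Walk v v),
      p.IsCycle → q.IsCycle → e ∈ p.edges → e ∈ q.edges → p.toSubgraph = q.toSubgraph

/-- The least weight of an edge in a connected graph on `n ≥ 4` vertices, before cubing. -/
theorem div_sub_two_le_edge_ratio {n a b : ℝ} (hn : 4 ≤ n) (ha : a = 1 ∨ 2 ≤ a)
    (hb : b = 1 ∨ 2 ≤ b) (hab : ¬(a = 1 ∧ b = 1)) (han : a ≤ n - 1) (hbn : b ≤ n - 1) :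
    (n - 1) / (n - 2) ≤ a * b / (a + b - 2) ∧
      (a * b / (a + b - 2) = (n - 1) / (n - 2) → a = 1 ∧ b = n - 1 ∨ a = n - 1 ∧ b = 1) := by
  have hn2 : 0 < n - 2 := by linarith
  rcases ha with rfl | ha <;> rcases hb with rfl | hb
  · exact absurd ⟨rfl, rfl⟩ hab
  · have hs : 0 < 1 + b - 2 := by linarith
    rw [div_le_div_iff₀ hn2 hs, div_eq_div_iff hs.ne' hn2.ne']
    exact ⟨by linarith, fun h => Or.inl ⟨rfl, by linarith⟩⟩
  · have hs : 0 < a + 1 - 2 := by linarith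
    rw [div_le_div_iff₀ hn2 hs, div_eq_div_iff hs.ne' hn2.ne']
    exact ⟨by linarith, fun h => Or.inr ⟨by linarith, rfl⟩⟩
  · have hs : 0 < a + b - 2 := by linarith
    have h1 : (n - 1) / (n - 2) < 2 := by rw [div_lt_iff₀ hn2]; linarith
    have h2 : 2 ≤ a * b / (a + b - 2) := by
      rw [le_div_iff₀ hs]
      linarith [mul_nonneg (sub_nonneg.2 ha) (sub_nonneg.2 hb)]
    exact ⟨by linarith, fun h => by linarith⟩

namespace SimpleGraph

variable {V : Type*} [Fintype V] {G : SimpleGraph V} [DecidableRel G.Adj]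

theorem Connected.not_degree_eq_one_and_degree_eq_one (hG : G.Connected)
    (hV : 2 < Fintype.card V) {u v : V} (huv : G.Adj u v) :
    ¬(G.degree u = 1 ∧ G.degree v = 1) := by
  classical
  rintro ⟨hu, hv⟩
  rw [degree_eq_one_iff_existsUnique_adj] at hu hv
  obtain ⟨w, -, hw⟩ := Finset.exists_mem_notMem_of_card_lt_card
    (s := {u, v}) (t := Finset.univ) (Finset.card_le_two.trans_lt (by simpa using hV))
  obtain ⟨p⟩ := hG.preconnected u w
  obtain ⟨d, -, hd, hd'⟩ := p.exists_boundary_dart {u, v} (by simp) (by simpa using hw)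
  have hadj := d.adj
  simp only [Set.mem_insert_iff, Set.mem_singleton_iff, not_or] at hd hd'
  rcases hd with h | h <;> rw [h] at hadj
  · exact hd'.2 (hu.unique hadj huv)
  · exact hd'.1 (hv.unique hadj huv.symm)

theorem Connected.edge_ratio_bound (hG : G.Connected) (hV : 4 ≤ Fintype.card V) {u v : V}
    (huv : G.Adj u v) :
    ((Fintype.card V : ℝ) - 1) / ((Fintype.card V : ℝ) - 2) ≤
        ((G.degree u : ℝ) * (G.degree v : ℝ)) / ((G.degree u : ℝ) + (G.degree v : ℝ) - 2) ∧
      (((G.degree u : ℝ) * (G.degree v : ℝ)) / ((G.degree u : ℝ) + (G.degree v : ℝ) - 2) =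
          ((Fintype.card V : ℝ) - 1) / ((Fintype.card V : ℝ) - 2) →
        G.degree u = 1 ∧ G.degree v = Fintype.card V - 1 ∨
          G.degree u = Fintype.card V - 1 ∧ G.degree v = 1) := by
  have key : ∀ w, 0 < G.degree w → ((G.degree w : ℝ) = 1 ∨ (2 : ℝ) ≤ G.degree w) := by
    intro w hw
    norm_cast
    omega
  have hle : ∀ w, (G.degree w : ℝ) ≤ (Fintype.card V : ℝ) - 1 := by
    intro w
    have := G.degree_lt_card_verts w
    rw [le_sub_iff_add_le]
    exact_mod_cast this
  have hcast : (Fintype.card V : ℝ) - 1 = ((Fintype.card V - 1 : ℕ) : ℝ) := by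
    rw [Nat.cast_sub (by omega), Nat.cast_one]
  obtain ⟨h1, h2⟩ := div_sub_two_le_edge_ratio (n := Fintype.card V) (by exact_mod_cast hV)
    (key u huv.degree_pos_left) (key v huv.degree_pos_right)
    (by exact_mod_cast hG.not_degree_eq_one_and_degree_eq_one (by omega) huv) (hle u) (hle v)
  refine ⟨h1, fun h => ?_⟩
  have h3 := h2 h
  rw [hcast] at h3
  exact_mod_cast h3

theorem Connected.card_sub_one_le_card_edgeFinset [DecidableEq V] (hG : G.Connected) :
    (Fintype.card V : ℝ) - 1 ≤ (G.edgeFinset.card : ℝ) := by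
  have h := hG.card_vert_le_card_edgeSet_add_one
  rw [Nat.card_eq_fintype_card, Nat.card_eq_fintype_card, ← edgeFinset_card] at h
  rw [sub_le_iff_le_add]
  exact_mod_cast h

/-- A graph in which every edge joins a leaf to a universal vertex is a star. -/
theorem nonempty_iso_starGraph_of_degrees {n : ℕ} (hV : Fintype.card V = n) (hn : 3 ≤ n)
    (r : Fin n) (hE : ∃ u v, G.Adj u v)
    (h : ∀ u v, G.Adj u v → G.degree u = 1 ∧ G.degree v = n - 1 ∨
      G.degree u = n - 1 ∧ G.degree v = 1) : Nonempty (G ≃g starGraph r) := by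
  classical
  obtain ⟨z, hz⟩ : ∃ z, G.degree z = n - 1 := by
    obtain ⟨u, v, huv⟩ := hE
    rcases h u v huv with h | h
    exacts [⟨v, h.2⟩, ⟨u, h.1⟩]
  have huniv : ∀ w, z ≠ w → G.Adj z w := by
    rw [← hV, degree_eq_card_sub_one] at hz
    exact fun w hw => hz hw
  have hcenter : ∀ w, G.degree w = n - 1 → w = z := by
    intro w hw
    by_contra hne
    rcases h z w (huniv w (Ne.symm hne)) with h | h <;> omega
  let e : V ≃ Fin n := Fintype.equivFinOfCardEq hV
  let e' : V ≃ Fin n := e.trans (Equiv.swap (e z) r)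
  have he' : e' z = r := by simp [e']
  refine ⟨⟨e', fun {u v} => ?_⟩⟩
  rw [starGraph_adj, ← he', e'.injective.ne_iff, e'.injective.eq_iff, e'.injective.eq_iff]
  constructor
  · rintro ⟨hne, rfl | rfl⟩
    exacts [huniv v hne, (huniv u hne.symm).symm]
  · intro huv
    refine ⟨huv.ne, ?_⟩
    rcases h u v huv with h | h
    exacts [Or.inr (hcenter v h.2), Or.inl (hcenter u h.1)]

end SimpleGraph

theorem augmentedZagrebIndex_eq_of_iso_starGraph {V : Type*} [Fintype V] [DecidableEq V]
    {G : SimpleGraph V} [DecidableRel G.Adj] {n : ℕ} (hn : 1 ≤ n) {r : Fin n}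
    (f : G ≃g SimpleGraph.starGraph r) :
    augmentedZagrebIndex G = ((n : ℝ) - 1) * (((n : ℝ) - 1) / ((n : ℝ) - 2)) ^ 3 := by
  have hcast : ((n - 1 : ℕ) : ℝ) = (n : ℝ) - 1 := by rw [Nat.cast_sub hn, Nat.cast_one]
  have hcard : G.edgeFinset.card = n - 1 := by
    rw [f.card_edgeFinset_eq]
    have := (SimpleGraph.isTree_starGraph r).card_edgeFinset
    rw [Fintype.card_fin] at this
    omega
  have hc : ∀ v, f v = r → (G.degree v : ℝ) = (n : ℝ) - 1 := by
    intro v hv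
    rw [← f.degree_eq, hv, SimpleGraph.degree_starGraph_center, Fintype.card_fin, hcast]
  have hl : ∀ v, f v ≠ r → (G.degree v : ℝ) = 1 := by
    intro v hv
    rw [← f.degree_eq, SimpleGraph.degree_starGraph_of_ne_center hv, Nat.cast_one]
  refine (Finset.sum_eq_card_nsmul (b := (((n : ℝ) - 1) / ((n : ℝ) - 2)) ^ 3)
    fun e he => ?_).trans (by rw [hcard, nsmul_eq_mul, hcast])
  induction e using Sym2.ind with
  | _ u v =>
    rw [SimpleGraph.mem_edgeFinset, SimpleGraph.mem_edgeSet, ← f.map_adj_iff,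
      SimpleGraph.starGraph_adj] at he
    obtain ⟨hne, hu | hv⟩ := he
    · rw [Sym2.lift_mk]
      simp only [hc u hu, hl v (fun h => hne (hu.trans h.symm))]
      congr 2 <;> ring
    · rw [Sym2.lift_mk]
      simp only [hc v hv, hl u (fun h => hne (h.trans hv.symm))]
      congr 2 <;> ring

theorem mainTheorem2 {V : Type*} [Fintype V] [DecidableEq V] (G : SimpleGraph V)
    [DecidableRel G.Adj] (n : ℕ) (hn : 4 ≤ n) (hV : Fintype.card V = n) (hG : IsCactus G) :
    ((n : ℝ) - 1) * (((n : ℝ) - 1) / ((n : ℝ) - 2)) ^ 3 ≤ augmentedZagrebIndex G ∧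
      (augmentedZagrebIndex G = ((n : ℝ) - 1) * (((n : ℝ) - 1) / ((n : ℝ) - 2)) ^ 3 ↔
        Nonempty (G ≃g SimpleGraph.starGraph (⟨0, by omega⟩ : Fin n))) := by
  have hconn : G.Connected := hG.1
  have hnR : (4 : ℝ) ≤ n := by exact_mod_cast hn
  have hm := hconn.card_sub_one_le_card_edgeFinset
  have hedge := fun u v huv => hconn.edge_ratio_bound (hV ▸ hn) (u := u) (v := v) huv
  rw [hV] at hm
  simp only [hV] at hedge
  have hpos : 0 < ((n : ℝ) - 1) / ((n : ℝ) - 2) := div_pos (by linarith) (by linarith)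
  set c : ℝ := (((n : ℝ) - 1) / ((n : ℝ) - 2)) ^ 3 with hc
  have hcpos : 0 < c := pow_pos hpos 3
  have hterm : ∀ e ∈ G.edgeFinset, c ≤ Sym2.lift ⟨fun u v : V =>
      (((G.degree u : ℝ) * (G.degree v : ℝ)) / ((G.degree u : ℝ) + (G.degree v : ℝ) - 2)) ^ 3,
      fun u v => by
        simp only [mul_comm (G.degree u : ℝ), add_comm (G.degree u : ℝ)]⟩ e := by
    intro e he
    induction e using Sym2.ind with
    | _ u v =>
      rw [SimpleGraph.mem_edgeFinset, SimpleGraph.mem_edgeSet] at he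
      exact pow_le_pow_left₀ hpos.le (hedge u v he).1 3
  have hsum : (G.edgeFinset.card : ℝ) * c ≤ augmentedZagrebIndex G := by
    rw [← nsmul_eq_mul]
    exact Finset.card_nsmul_le_sum _ _ _ hterm
  have hbound := (mul_le_mul_of_nonneg_right hm hcpos.le).trans hsum
  refine ⟨hbound, fun heq => ?_, fun ⟨f⟩ =>
    augmentedZagrebIndex_eq_of_iso_starGraph (by omega) f⟩
  have hle : ∑ _e ∈ G.edgeFinset, c = augmentedZagrebIndex G := by
    rw [Finset.sum_const, nsmul_eq_mul]
    exact hsum.antisymm (heq.trans_le (mul_le_mul_of_nonneg_right hm hcpos.le))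
  have hall := (Finset.sum_eq_sum_iff_of_le hterm).1 hle
  have : Nontrivial V := Fintype.one_lt_card_iff_nontrivial.1 (by omega)
  obtain ⟨u₀⟩ := hconn.nonempty
  obtain ⟨v₀, huv₀⟩ := (G.degree_pos_iff_exists_adj u₀).1
    (hconn.preconnected.degree_pos_of_nontrivial u₀)
  refine SimpleGraph.nonempty_iso_starGraph_of_degrees hV (by omega) _ ⟨u₀, v₀, huv₀⟩ ?_
  intro u v huv
  obtain ⟨h1, h2⟩ := hedge u v huv
  have h3 := hall s(u, v) (by simpa using huv)
  rw [Sym2.lift_mk] at h3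
  exact h2 ((pow_left_inj₀ (hpos.le.trans h1) hpos.le three_ne_zero).1 h3.symm)
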